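/- Let $K$ be a field and $k\ge 0$. A dissimilarity on a set $X$ is a function $d:X\times X\to\mathbb{R}_{\ge 0}$ with $d(x,x)=0$ for all $x$. Let $(X,d_X)$ and $(Y,d_Y)$ be finite dissimilarity spaces (for instance a data set and its embedding). For $r\in\mathbb{R}$ let $H_k(X;r)$ be the $k$-th simplicial homology, with coefficients in $K$, of the Vietoris–Rips complex of $(X,d_X)$ at parameter $r$, whose simplices are the nonempty finite subsets with all pairwise dissimilarities $\le r$. Let $H_k(X)$ be the persistence vector space formed by the $H_k(X;r)$ with the maps induced by inclusion; likewise $H_k(Y)$. An $\epsilon$-interleaving between persistence vector spaces $V$ and $W$ is a pair of families of linear maps $f_r:V_r\to W_{r+\epsilon}$ and $g_r:W_r\to V_{r+\epsilon}$ that commute with the structure maps, such that $g_{r+\epsilon}f_r$ and $f_{r+\epsilon}g_r$ are the structure maps $V_r\to V_{r+2\epsilon}$ and $W_r\to W_{r+2\epsilon}$. The interleaving distance $d_{\mathrm I}(V,W)$ is the infimum of the $\epsilon\ge 0$ for which an $\epsilon$-interleaving exists. Let $\epsilon=d_{\mathrm I}(H_k(Y),H_k(X))$, and suppose $\epsilon<\infty$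 (this is automatic when $X$ and $Y$ are both nonempty). Then there is an $\epsilon$-interleaving $(f,g)$ between $H_k(Y)$ and $H_k(X)$. Moreover, let $(f,g)$ be any such interleaving. Fix any interval decomposition of $H_k(Y)$, with persistence pairs $(b_i,d_i)_{i\in I}$, $b_i<d_i\le\infty$, and generators $v_i\in H_k(Y;b_i)$, so that for every $r$ the images of the $v_i$ with $b_i\le r<d_i$ form a basis of $H_k(Y;r)$, and the image of $v_i$ in $H_k(Y;r)$ is $0$ for real $r\ge d_i$. Select the pairs with $|d_i-b_i|>2\epsilon$. Then no topological type-I error is made, in the following sense. 1. For every selected $i$, the image $f_{b_i}(v_i)\in H_k(X;b_i+\epsilon)$ is nonzero. 2. Distinct selected classes have distinct images: if $i\ne j$ are selected, then $f_{b_i}(v_i)$ and $f_{b_j}(v_j)$ have different images in $H_k(X;\max(b_i,b_j)+\epsilon)$; in particular, if $b_i=b_j=b$, they are different in $H_k(X;b+\epsilon)$. 3. Every selected feature has a corresponding feature of $X$, and different selected features can be given different ones: for any interval decomposition of $H_k(X)$ there is an injective map $\varphi$ from the selected pairs of $H_k(Y)$ to the persistence pairs of $H_k(X)$ such that, for every selected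 $i$, the pair $\varphi(i)=(b',d')$ satisfies $b'\le b_i+\epsilon<d'$ and $f_{b_i}(v_i)$ has a nonzero coefficient on the basis vector of $H_k(X;b_i+\epsilon)$ given by $\varphi(i)$. -/

import Mathlib

open scoped NNReal ENNReal

universe u v w

/-! ### Quotients `Z / B` of subspaces `B ⊆ Z` -/

section Subquotient

variable {K : Type u} [Field K] {M : Type v} [AddCommGroup M] [Module K M]

/-- The quotient `Z / B` for subspaces `B ⊆ Z` of `M` (in general `Z / (Z ∩ B)`). -/
def Subquotient (Z B : Submodule K M) : Type v := Z ⧸ B.submoduleOf Z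

namespace Subquotient

noncomputable instance (Z B : Submodule K M) : AddCommGroup (Subquotient Z B) :=
  inferInstanceAs (AddCommGroup (Z ⧸ B.submoduleOf Z))

noncomputable instance (Z B : Submodule K M) : Module K (Subquotient Z B) :=
  inferInstanceAs (Module K (Z ⧸ B.submoduleOf Z))

/-- The projection `Z → Z / B`. -/
noncomputable def mk (Z B : Submodule K M) : Z →ₗ[K] Subquotient Z B := (B.submoduleOf Z).mkQ

theorem mk_surjective (Z B : Submodule K M) : Function.Surjective (mk Z B) :=
  Submodule.mkQ_surjective _

theorem mk_eq_zero {Z B : Submodule K M} (z : Z) : mk Z B z = 0 ↔ (z : M) ∈ B :=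
  Submodule.Quotient.mk_eq_zero (B.submoduleOf Z)

/-- The map `Z / B → Z' / B'` induced by inclusions `Z ⊆ Z'` and `B ⊆ B'`. -/
noncomputable def map {Z B Z' B' : Submodule K M} (hZ : Z ≤ Z') (hB : B ≤ B') :
    Subquotient Z B →ₗ[K] Subquotient Z' B' :=
  Submodule.mapQ _ _ (Submodule.inclusion hZ) fun _ hz => hB hz

theorem map_mk {Z B Z' B' : Submodule K M} (hZ : Z ≤ Z') (hB : B ≤ B') (z : Z) :
    map hZ hB (mk Z B z) = mk Z' B' (Submodule.inclusion hZ z) := rfl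

end Subquotient

end Subquotient

/-! ### Simplicial homology with field coefficients -/

set_option linter.unusedSectionVars false

namespace SimplicialHomology

variable (K : Type u) [Field K] {X : Type v} [LinearOrder X]

/-- The oriented boundary of one simplex `s`, whose vertices are listed in increasing order: the
alternating sum of its codimension-one faces. The empty set is not a face, so the boundary of a
vertex is `0` (homology is not reduced). -/
noncomputable def boundaryOf (s : Finset X) : Finset X →₀ K :=
  ∑ x ∈ s with (s.erase x).Nonempty,
    Finsupp.single (s.erase x) ((-1 : K) ^ (s.filter (· < x)).card)

/-- The boundary map, extended linearly from `boundaryOf`. -/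
noncomputable def boundary : (Finset X →₀ K) →ₗ[K] (Finset X →₀ K) :=
  Finsupp.linearCombination K (boundaryOf K)

/-- The space `C_k(A)` of `k`-chains: it has as basis the `k`-simplices of `A`, that is, the faces
with `k + 1` vertices. -/
def chains (A : PreAbstractSimplicialComplex X) (k : ℕ) : Submodule K (Finset X →₀ K) :=
  Finsupp.supported K K {s | s ∈ A ∧ s.card = k + 1}

/-- The `k`-cycles `ker ∂_k`. -/
noncomputable def cycles (A : PreAbstractSimplicialComplex X) (k : ℕ) :
    Submodule K (Finset X →₀ K) :=
  chains K A k ⊓ LinearMap.ker (boundary K)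

/-- The `k`-boundaries `im ∂_{k+1}`. -/
noncomputable def boundaries (A : PreAbstractSimplicialComplex X) (k : ℕ) :
    Submodule K (Finset X →₀ K) :=
  (chains K A (k + 1)).map (boundary K)

/-- Removing `x` and then `y`, or `y` and then `x`, gives opposite signs. -/
theorem sign_swap (s : Finset X) {x y : X} (hx : x ∈ s) (hy : y ∈ s) (hxy : x ≠ y) :
    (-1 : K) ^ (s.filter (· < x)).card * (-1 : K) ^ ((s.erase x).filter (· < y)).card
      + (-1 : K) ^ (s.filter (· < y)).card * (-1 : K) ^ ((s.erase y).filter (· < x)).card = 0 := by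
  wlog h : x < y generalizing x y
  · rw [add_comm]
    exact this hy hx hxy.symm (lt_of_le_of_ne (not_lt.mp h) hxy.symm)
  have h1 : (s.filter (· < y)).card = ((s.erase x).filter (· < y)).card + 1 := by
    rw [Finset.filter_erase, Finset.card_erase_add_one]
    simp [hx, h]
  have h2 : ((s.erase y).filter (· < x)).card = (s.filter (· < x)).card := by
    rw [Finset.filter_erase, Finset.erase_eq_of_notMem]
    simp [h.le]
  rw [h1, h2, pow_succ]
  ring

theorem boundary_boundaryOf (s : Finset X) : boundary K (boundaryOf K s) = 0 := by
  by_cases hs : s.card ≤ 2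
  · rw [boundaryOf, map_sum]
    refine Finset.sum_eq_zero fun x hx => ?_
    rw [Finset.mem_filter] at hx
    have hc : (s.erase x).card ≤ 1 := by
      rw [Finset.card_erase_of_mem hx.1]
      omega
    have h0 : boundaryOf K (s.erase x) = 0 := by
      rw [boundaryOf]
      refine Finset.sum_eq_zero fun y hy => ?_
      rw [Finset.mem_filter] at hy
      have h1 := Finset.card_erase_of_mem hy.1
      have h2 := Finset.card_pos.mpr hy.2
      omega
    rw [boundary, Finsupp.linearCombination_single, h0, smul_zero]
  · have key : ∀ t : Finset X, 1 < t.card →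
        boundaryOf K t = ∑ x ∈ t, Finsupp.single (t.erase x)
          ((-1 : K) ^ (t.filter (· < x)).card) := by
      intro t ht
      rw [boundaryOf, Finset.filter_true_of_mem]
      intro x hx
      rw [← Finset.card_pos, Finset.card_erase_of_mem hx]
      omega
    rw [key s (by omega), map_sum]
    have h2 : ∀ x ∈ s, boundary K (Finsupp.single (s.erase x)
          ((-1 : K) ^ (s.filter (· < x)).card)) =
        ∑ y ∈ s.erase x, Finsupp.single ((s.erase x).erase y)
          ((-1 : K) ^ (s.filter (· < x)).card *
            (-1 : K) ^ ((s.erase x).filter (· < y)).card) := by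
      intro x hx
      rw [boundary, Finsupp.linearCombination_single, key, Finset.smul_sum]
      · simp
      · rw [Finset.card_erase_of_mem hx]
        omega
    rw [Finset.sum_congr rfl h2, Finset.sum_sigma']
    refine Finset.sum_involution (fun p _ => ⟨p.2, p.1⟩) ?_ ?_ ?_ ?_
    · rintro ⟨x, y⟩ hp
      simp only [Finset.mem_sigma, Finset.mem_erase] at hp
      dsimp only
      rw [Finset.erase_right_comm (a := y) (b := x), ← Finsupp.single_add,
        sign_swap K s hp.1 hp.2.2 (Ne.symm hp.2.1), Finsupp.single_zero]
    · rintro ⟨x, y⟩ hp _ h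
      simp only [Finset.mem_sigma, Finset.mem_erase] at hp
      simp only [Sigma.mk.injEq] at h
      exact hp.2.1 h.1
    · rintro ⟨x, y⟩ hp
      simp only [Finset.mem_sigma, Finset.mem_erase] at hp ⊢
      exact ⟨hp.2.2, Ne.symm hp.2.1, hp.1⟩
    · rintro ⟨x, y⟩ hp
      rfl

/-- `∂ ∘ ∂ = 0`. -/
theorem boundary_boundary (c : Finset X →₀ K) : boundary K (boundary K c) = 0 := by
  induction c using Finsupp.induction_linear with
  | zero => simp
  | add f g hf hg => simp [hf, hg]
  | single s a =>
    rw [boundary, Finsupp.linearCombination_single, map_smul]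
    exact (congrArg (a • ·) (boundary_boundaryOf K s)).trans (smul_zero a)

theorem boundary_mem_chains (A : PreAbstractSimplicialComplex X) (k : ℕ) {c : Finset X →₀ K}
    (hc : c ∈ chains K A (k + 1)) : boundary K c ∈ chains K A k := by
  rw [boundary, Finsupp.linearCombination_apply]
  refine Submodule.sum_mem _ fun s hs => Submodule.smul_mem _ _ ?_
  have hsA := (Finsupp.mem_supported K c).mp hc hs
  refine Submodule.sum_mem _ fun x hx => ?_
  rw [Finset.mem_filter] at hx
  refine Finsupp.single_mem_supported K _ ⟨?_, ?_⟩
  · exact (A.isRelLowerSet_faces hsA.1).2 (Finset.erase_subset x s) hx.2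
  · rw [Finset.card_erase_of_mem hx.1, hsA.2]
    rfl

/-- `im ∂_{k+1} ⊆ ker ∂_k`. -/
theorem boundaries_le_cycles (A : PreAbstractSimplicialComplex X) (k : ℕ) :
    boundaries K A k ≤ cycles K A k := by
  rintro _ ⟨c, hc, rfl⟩
  exact ⟨boundary_mem_chains K A k hc, boundary_boundary K c⟩

/-- `H_k(A) = ker ∂_k / im ∂_{k+1}`, with coefficients in `K`. -/
abbrev Homology (A : PreAbstractSimplicialComplex X) (k : ℕ) : Type (max u v) :=
  Subquotient (cycles K A k) (boundaries K A k)

variable {A B C : PreAbstractSimplicialComplex X}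

theorem chains_mono (h : A ≤ B) (k : ℕ) : chains K A k ≤ chains K B k :=
  Finsupp.supported_mono fun _ hs => ⟨h hs.1, hs.2⟩

theorem cycles_mono (h : A ≤ B) (k : ℕ) : cycles K A k ≤ cycles K B k :=
  inf_le_inf_right _ (chains_mono K h k)

theorem boundaries_mono (h : A ≤ B) (k : ℕ) : boundaries K A k ≤ boundaries K B k :=
  Submodule.map_mono (chains_mono K h (k + 1))

/-- The map `H_k(A) → H_k(B)` induced by an inclusion `A ⊆ B` of complexes. -/
noncomputable def homologyMap (h : A ≤ B) (k : ℕ) : Homology K A k →ₗ[K] Homology K B k :=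
  Subquotient.map (cycles_mono K h k) (boundaries_mono K h k)

theorem homologyMap_refl (k : ℕ) :
    homologyMap K (le_refl A) k = LinearMap.id := by
  refine LinearMap.ext fun z => ?_
  obtain ⟨z, rfl⟩ := Subquotient.mk_surjective _ _ z
  rfl

theorem homologyMap_comp (h : A ≤ B) (h' : B ≤ C) (k : ℕ) :
    homologyMap K h' k ∘ₗ homologyMap K h k = homologyMap K (h.trans h') k := by
  refine LinearMap.ext fun z => ?_
  obtain ⟨z, rfl⟩ := Subquotient.mk_surjective _ _ z
  rfl

end SimplicialHomology

/-! ### Persistence vector spaces, interleavings, interval decompositions -/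

/-- A one-parameter persistence vector space over `K`. -/
structure PersistenceSpace (K : Type u) [Field K] where
  /-- the vector space at parameter `r` -/
  obj : ℝ → Type v
  [addCommGroup : ∀ r, AddCommGroup (obj r)]
  [module : ∀ r, Module K (obj r)]
  /-- the structure maps -/
  map : ∀ {r s : ℝ}, r ≤ s → obj r →ₗ[K] obj s
  map_refl : ∀ r, map (le_refl r) = LinearMap.id
  map_comp : ∀ {r s t : ℝ} (h : r ≤ s) (h' : s ≤ t), map h' ∘ₗ map h = map (h.trans h')

attribute [instance] PersistenceSpace.addCommGroup PersistenceSpace.module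

theorem le_add_shift (r : ℝ) (ε : ℝ≥0) : r ≤ r + ε + ε := by
  have := ε.coe_nonneg
  linarith

section Persistence

variable {K : Type u} [Field K]

/-- An `ε`-interleaving between `V` and `W`: two `ε`-shift maps `f : V → W` and `g : W → V` whose
composites are the structure maps of shift `2ε`. -/
structure Interleaving (ε : ℝ≥0) (V : PersistenceSpace.{u, v} K)
    (W : PersistenceSpace.{u, w} K) where
  f : ∀ r : ℝ, V.obj r →ₗ[K] W.obj (r + ε)
  g : ∀ r : ℝ, W.obj r →ₗ[K] V.obj (r + ε)
  f_natural : ∀ {r s : ℝ} (h : r ≤ s) (x : V.obj r),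
    f s (V.map h x) = W.map (add_le_add_left h (ε : ℝ)) (f r x)
  g_natural : ∀ {r s : ℝ} (h : r ≤ s) (y : W.obj r),
    g s (W.map h y) = V.map (add_le_add_left h (ε : ℝ)) (g r y)
  g_f : ∀ (r : ℝ) (x : V.obj r), g (r + ε) (f r x) = V.map (le_add_shift r ε) x
  f_g : ∀ (r : ℝ) (y : W.obj r), f (r + ε) (g r y) = W.map (le_add_shift r ε) y

/-- The interleaving distance, `∞` if there is no interleaving at all. -/
noncomputable def interleavingDist (V : PersistenceSpace.{u, v} K)
    (W : PersistenceSpace.{u, w} K) : ℝ≥0∞ :=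
  ⨅ (ε : ℝ≥0) (_ : Nonempty (Interleaving ε V W)), (ε : ℝ≥0∞)

/-- A decomposition of `V` into interval summands, given by the generators of the summands: the
pair `i` is represented by the class `gen i`, which appears at `birth i`, vanishes from `death i`
on (`death i = ⊤` if it never does), and at each parameter `r` the images of the generators of the
pairs with `birth i ≤ r < death i` form a basis of `V.obj r`. The family of the pairs
`(birth i, death i)` is the barcode of `V`. -/
structure IntervalDecomposition (V : PersistenceSpace.{u, v} K) (ι : Type w) where
  birth : ι → ℝ
  death : ι → EReal
  birth_lt_death : ∀ i, (birth i : EReal) < death i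
  gen : ∀ i, V.obj (birth i)
  map_gen_eq_zero : ∀ i (r : ℝ) (h : birth i ≤ r), death i ≤ (r : EReal) → V.map h (gen i) = 0
  linearIndependent : ∀ r : ℝ, LinearIndependent K
    (fun i : {i : ι // birth i ≤ r ∧ (r : EReal) < death i} => V.map i.2.1 (gen i.1))
  span_eq_top : ∀ r : ℝ, Submodule.span K (Set.range
    (fun i : {i : ι // birth i ≤ r ∧ (r : EReal) < death i} => V.map i.2.1 (gen i.1))) = ⊤

namespace IntervalDecomposition

variable {V : PersistenceSpace.{u, v} K} {ι : Type w}

/-- The basis of `V.obj r` given by the pairs that are alive at `r`. -/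
noncomputable def basis (P : IntervalDecomposition V ι) (r : ℝ) :
    Module.Basis {i : ι // P.birth i ≤ r ∧ (r : EReal) < P.death i} K (V.obj r) :=
  Module.Basis.mk (P.linearIndependent r) (P.span_eq_top r).ge

/-- The length `d - b` of a persistence pair. -/
noncomputable def length (P : IntervalDecomposition V ι) (i : ι) : EReal :=
  P.death i - (P.birth i : EReal)

/-- The pair `i` is selected at threshold `2ε` if its length exceeds `2ε`. -/
def IsSelected (P : IntervalDecomposition V ι) (ε : ℝ≥0) (i : ι) : Prop :=
  ((2 * (ε : ℝ) : ℝ) : EReal) < P.length i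

/-- The class `x`, living at parameter `r`, has a nonzero component along the pair `i`. -/
def HasComponent (P : IntervalDecomposition V ι) (r : ℝ) (x : V.obj r) (i : ι) : Prop :=
  ∃ h : P.birth i ≤ r ∧ (r : EReal) < P.death i, (P.basis r).repr x ⟨i, h⟩ ≠ 0

end IntervalDecomposition

end Persistence

/-! ### Vietoris–Rips filtrations of dissimilarity spaces -/

/-- A dissimilarity on `X`. Neither symmetry nor the triangle inequality is required. -/
structure Dissimilarity (X : Type v) where
  d : X → X → ℝ
  nonneg : ∀ x y, 0 ≤ d x y
  self : ∀ x, d x x = 0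

namespace Dissimilarity

variable {X : Type v}

/-- The Vietoris–Rips complex at parameter `r`: the simplices are the nonempty finite sets of
points with all pairwise dissimilarities at most `r`. -/
def rips (D : Dissimilarity X) (r : ℝ) : PreAbstractSimplicialComplex X where
  faces := {s | s.Nonempty ∧ ∀ x ∈ s, ∀ y ∈ s, D.d x y ≤ r}
  isRelLowerSet_faces := fun _ hs =>
    ⟨hs.1, fun _ hts ht => ⟨ht, fun x hx y hy => hs.2 x (hts hx) y (hts hy)⟩⟩

theorem rips_mono (D : Dissimilarity X) {r s : ℝ} (h : r ≤ s) : D.rips r ≤ D.rips s :=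
  fun _ ht => ⟨ht.1, fun x hx y hy => (ht.2 x hx y hy).trans h⟩

/-- The `k`-dimensional persistent homology of the Vietoris–Rips filtration, with coefficients in
`K`. -/
noncomputable def persistentHomology (K : Type u) [Field K] [LinearOrder X] (D : Dissimilarity X)
    (k : ℕ) : PersistenceSpace.{u, max u v} K where
  obj r := SimplicialHomology.Homology K (D.rips r) k
  map h := SimplicialHomology.homologyMap K (D.rips_mono h) k
  map_refl _ := SimplicialHomology.homologyMap_refl K k
  map_comp h h' := SimplicialHomology.homologyMap_comp K (D.rips_mono h) (D.rips_mono h') k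

end Dissimilarity

/-! The infimum is attained because both Rips filtrations change only at the finitely many
dissimilarity values. Take an `ε'`-interleaving with `ε'` slightly above `ε` and round each
parameter `r` down to `ρ r`, chosen so that no value lies in `(ρ r, r]`, nor between `ρ r + ε` and
`ρ r + ε'`, nor between `ρ r + 2ε` and `ρ r + 2ε'`. The structure maps there are isomorphisms, and
undoing them turns the `ε'`-shift maps into `ε`-shift maps (`Interleaving.nonempty_of_stable`,
`exists_monotone_floor`).

For the selected pairs, `g ∘ f` is the structure map of shift `2ε`, so whatever `f` kills at `r` is
zero at `r + 2ε`; generators alive at `r + 2ε` therefore do not occur in it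
(`eq_zero_of_f_eval_eq_zero`). A single generator gives claim 1. The difference of two, taken at the
later birth, gives claim 2. An arbitrary combination, taken at the latest birth, shows that the
coefficient vectors of the images are linearly independent, and Hall's marriage theorem on their
supports gives claim 3. -/

theorem PersistenceSpace.map_map {K : Type u} [Field K] (V : PersistenceSpace.{u, v} K)
    {r s t : ℝ} (h : r ≤ s) (h' : s ≤ t) (x : V.obj r) :
    V.map h' (V.map h x) = V.map (h.trans h') x :=
  LinearMap.congr_fun (V.map_comp h h') x

theorem PersistenceSpace.map_self {K : Type u} [Field K] (V : PersistenceSpace.{u, v} K)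
    {r : ℝ} (h : r ≤ r) (x : V.obj r) : V.map h x = x :=
  LinearMap.congr_fun (V.map_refl r) x

/-! ### Lowering the shift of an interleaving -/

section Lowering

variable {K : Type u} [Field K] {V : PersistenceSpace.{u, v} K} {W : PersistenceSpace.{u, w} K}

/-- A natural `ε'`-shift map `V → W` factors through a natural `ε`-shift map if `V` does not change
between `ρ r` and `r` and `W` does not change between `ρ r + ε` and `ρ r + ε'`. -/
theorem exists_lower_shift {ε ε' : ℝ} (hεε' : ε ≤ ε') {ρ : ℝ → ℝ} (hmono : Monotone ρ)
    (hρ : ∀ r, ρ r ≤ r) (hV : ∀ r, Function.Bijective (V.map (hρ r)))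
    (hW : ∀ r, Function.Bijective (W.map (add_le_add_right hεε' (ρ r))))
    (f' : ∀ r : ℝ, V.obj r →ₗ[K] W.obj (r + ε'))
    (hf' : ∀ {r s : ℝ} (h : r ≤ s) (x : V.obj r),
      f' s (V.map h x) = W.map (add_le_add_left h ε') (f' r x)) :
    ∃ f : ∀ r : ℝ, V.obj r →ₗ[K] W.obj (r + ε),
      (∀ {r s : ℝ} (h : r ≤ s) (x : V.obj r),
        f s (V.map h x) = W.map (add_le_add_left h ε) (f r x)) ∧
      ∀ r (x : V.obj r), W.map (add_le_add_right hεε' r) (f r x) = f' r x := by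
  let e r := LinearEquiv.ofBijective _ (hV r)
  let u r := LinearEquiv.ofBijective _ (hW r)
  have he : ∀ r x, V.map (hρ r) ((e r).symm x) = x := fun r x => (e r).apply_symm_apply x
  have hu : ∀ r x, W.map (add_le_add_right hεε' (ρ r)) ((u r).symm x) = x :=
    fun r x => (u r).apply_symm_apply x
  -- Pull back from `r` to `ρ r`, apply `f'`, pull back from `ρ r + ε'` to `ρ r + ε`, then push
  -- forward to `r + ε`.
  refine ⟨fun r => W.map (add_le_add_left (hρ r) ε) ∘ₗ (u r).symm.toLinearMap ∘ₗ f' (ρ r) ∘ₗ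
    (e r).symm.toLinearMap, ?_, ?_⟩
  · intro r s h x
    have h1 : (e s).symm (V.map h x) = V.map (hmono h) ((e r).symm x) := by
      apply (hV s).1
      rw [he, V.map_map, ← V.map_map (hρ r) h, he]
    have h2 : ∀ y, (u s).symm (W.map (add_le_add_left (hmono h) ε') y) =
        W.map (add_le_add_left (hmono h) ε) ((u r).symm y) := by
      intro y
      apply (hW s).1
      rw [hu, W.map_map,
        ← W.map_map (add_le_add_right hεε' (ρ r)) (add_le_add_left (hmono h) ε'), hu]
    simp only [LinearMap.comp_apply, LinearEquiv.coe_coe, h1, hf', h2, W.map_map]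
  · intro r x
    simp only [LinearMap.comp_apply, LinearEquiv.coe_coe, W.map_map]
    rw [← W.map_map (add_le_add_right hεε' (ρ r)) (add_le_add_left (hρ r) ε'), hu, ← hf' (hρ r), he]

/-- The composite of the lowered shift maps is a structure map if that holds for the original shift
maps. -/
theorem lower_shift_comp {ε ε' : ℝ} (hεε' : ε ≤ ε') (h0 : ∀ r, r ≤ r + ε + ε)
    {ρ : ℝ → ℝ} (hρ : ∀ r, ρ r ≤ r) (hV : ∀ r, Function.Bijective (V.map (hρ r)))
    (hV2 : ∀ r, Function.Injective (V.map (add_le_add (add_le_add_right hεε' (ρ r)) hεε')))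
    {f : ∀ r : ℝ, V.obj r →ₗ[K] W.obj (r + ε)} {g : ∀ r : ℝ, W.obj r →ₗ[K] V.obj (r + ε)}
    {f' : ∀ r : ℝ, V.obj r →ₗ[K] W.obj (r + ε')} {g' : ∀ r : ℝ, W.obj r →ₗ[K] V.obj (r + ε')}
    (hf : ∀ {r s : ℝ} (h : r ≤ s) (x : V.obj r),
      f s (V.map h x) = W.map (add_le_add_left h ε) (f r x))
    (hg : ∀ {r s : ℝ} (h : r ≤ s) (x : W.obj r),
      g s (W.map h x) = V.map (add_le_add_left h ε) (g r x))
    (hg' : ∀ {r s : ℝ} (h : r ≤ s) (x : W.obj r),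
      g' s (W.map h x) = V.map (add_le_add_left h ε') (g' r x))
    (hff' : ∀ r (x : V.obj r), W.map (add_le_add_right hεε' r) (f r x) = f' r x)
    (hgg' : ∀ r (x : W.obj r), V.map (add_le_add_right hεε' r) (g r x) = g' r x)
    (hcomp : ∀ (r : ℝ) (x : V.obj r), g' (r + ε') (f' r x) =
      V.map ((h0 r).trans (add_le_add (add_le_add_right hεε' r) hεε')) x)
    (r : ℝ) (x : V.obj r) : g (r + ε) (f r x) = V.map (h0 r) x := by
  -- By naturality it suffices to treat `ρ r`, where `hV2` allows the comparison to be made after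
  -- shift `2ε'`.
  obtain ⟨x, rfl⟩ := (hV r).2 x
  have key : g (ρ r + ε) (f (ρ r) x) = V.map (h0 (ρ r)) x := by
    apply hV2 r
    rw [V.map_map, ← hcomp, ← hff', hg', ← hgg', V.map_map]
  rw [hf, hg, key, V.map_map, V.map_map]

theorem Interleaving.nonempty_of_stable {ε ε' : ℝ≥0} (Φ : Interleaving ε' V W)
    (hεε' : (ε : ℝ) ≤ ε') {ρ : ℝ → ℝ} (hmono : Monotone ρ) (hρ : ∀ r, ρ r ≤ r)
    (hV : ∀ r, Function.Bijective (V.map (hρ r)))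
    (hW : ∀ r, Function.Bijective (W.map (hρ r)))
    (hV1 : ∀ r, Function.Bijective (V.map (add_le_add_right hεε' (ρ r))))
    (hW1 : ∀ r, Function.Bijective (W.map (add_le_add_right hεε' (ρ r))))
    (hV2 : ∀ r, Function.Injective (V.map (add_le_add (add_le_add_right hεε' (ρ r)) hεε')))
    (hW2 : ∀ r, Function.Injective (W.map (add_le_add (add_le_add_right hεε' (ρ r)) hεε'))) :
    Nonempty (Interleaving ε V W) := by
  obtain ⟨f, hf, hff'⟩ := exists_lower_shift hεε' hmono hρ hV hW1 Φ.f Φ.f_natural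
  obtain ⟨g, hg, hgg'⟩ := exists_lower_shift hεε' hmono hρ hW hV1 Φ.g Φ.g_natural
  exact ⟨⟨f, g, hf, hg,
    lower_shift_comp hεε' (le_add_shift · ε) hρ hV hV2 hf hg Φ.g_natural hff' hgg' Φ.g_f,
    lower_shift_comp hεε' (le_add_shift · ε) hρ hW hW2 hg hf Φ.f_natural hgg' hff' Φ.f_g⟩⟩

end Lowering

/-! ### The interleaving distance is attained -/

theorem Dissimilarity.bijective_map_persistentHomology (K : Type u) [Field K] {X : Type v}
    [LinearOrder X] (D : Dissimilarity X) (k : ℕ) {r s : ℝ} (h : r ≤ s)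
    (hrs : ∀ x y, D.d x y ≤ s → D.d x y ≤ r) :
    Function.Bijective ((D.persistentHomology K k).map h) := by
  have h' : D.rips s ≤ D.rips r := fun _ ht => ⟨ht.1, fun x hx y hy => hrs x y (ht.2 x hx y hy)⟩
  refine Function.bijective_iff_has_inverse.2
    ⟨SimplicialHomology.homologyMap K h' k, fun x => ?_, fun x => ?_⟩
  · exact (LinearMap.congr_fun (SimplicialHomology.homologyMap_comp K (D.rips_mono h) h' k) x).trans
      (LinearMap.congr_fun (SimplicialHomology.homologyMap_refl K k) x)
  · exact (LinearMap.congr_fun (SimplicialHomology.homologyMap_comp K h' (D.rips_mono h) k) x).trans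
      (LinearMap.congr_fun (SimplicialHomology.homologyMap_refl K k) x)

/-- Only finitely many pairs `(a, c)` are involved, and each excludes only those `δ` with `δ ≥ c -
(a + ε) > 0`. -/
theorem exists_pos_forall_le_add_imp_le (C : Finset ℝ) (ε : ℝ) :
    ∃ δ > 0, ∀ a ∈ C, ∀ c ∈ C, c ≤ a + ε + δ → c ≤ a + ε := by
  have h : ∀ᶠ δ in nhdsWithin (0 : ℝ) (Set.Ioi 0),
      ∀ a ∈ C, ∀ c ∈ C, c ≤ a + ε + δ → c ≤ a + ε := by
    refine (Filter.eventually_all_finset C).2 fun a _ =>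
      (Filter.eventually_all_finset C).2 fun c _ => ?_
    by_cases hc : c ≤ a + ε
    · exact Filter.Eventually.of_forall fun _ _ => hc
    · have h0 : (0 : ℝ) < c - (a + ε) := by linarith
      filter_upwards [Ioo_mem_nhdsGT h0] with δ hδ h
      linarith [hδ.2]
  obtain ⟨δ, hδ, hδ0⟩ := (h.and self_mem_nhdsWithin).exists
  exact ⟨δ, hδ0, hδ⟩

/-- A monotone choice of parameters `ρ r ≤ r` with no element of `C` in `(ρ r, r]`, such that
moreover no element of `C` lies slightly above `ρ r + ε` or `ρ r + ε + ε`. -/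
theorem exists_monotone_floor (C : Finset ℝ) (hC : ∀ c ∈ C, 0 ≤ c) {ε : ℝ} (hε : 0 ≤ ε) :
    ∃ δ > 0, ∃ ρ : ℝ → ℝ, Monotone ρ ∧ (∀ r, ρ r ≤ r) ∧ ∀ c ∈ C, ∀ r,
      (c ≤ r → c ≤ ρ r) ∧ (c ≤ ρ r + ε + δ → c ≤ ρ r + ε) ∧
      (c ≤ ρ r + ε + ε + (δ + δ) → c ≤ ρ r + ε + ε) := by
  classical
  -- Inserting `0` ensures that every `r ≥ 0` has an element of the set below it.
  obtain ⟨δ₁, h₁, H₁⟩ := exists_pos_forall_le_add_imp_le (insert 0 C) ε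
  obtain ⟨δ₂, h₂, H₂⟩ := exists_pos_forall_le_add_imp_le (insert 0 C) (ε + ε)
  have hne : ∀ r : ℝ, 0 ≤ r → ((insert 0 C).filter (· ≤ r)).Nonempty := fun r hr =>
    ⟨0, by simp [hr]⟩
  let ρ : ℝ → ℝ := fun r => if h : 0 ≤ r then ((insert 0 C).filter (· ≤ r)).max' (hne r h)
    -- For `r < 0` this keeps `ρ r + 2ε + 2δ` negative when `δ ≤ 1`, so the conditions hold
    -- vacuously: `C` has no negative element.
    else r - 2 * ε - 2
  have hpos : ∀ r (h : 0 ≤ r), ρ r = ((insert 0 C).filter (· ≤ r)).max' (hne r h) :=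
    fun r h => dif_pos h
  have hneg : ∀ r, ¬ 0 ≤ r → ρ r = r - 2 * ε - 2 := fun r h => dif_neg h
  have hmem : ∀ r, 0 ≤ r → ρ r ∈ insert 0 C ∧ ρ r ≤ r := fun r h => by
    rw [hpos r h]
    exact Finset.mem_filter.1 (Finset.max'_mem _ (hne r h))
  have hle : ∀ r, 0 ≤ r → ∀ c ∈ insert 0 C, c ≤ r → c ≤ ρ r := fun r h c hc hcr => by
    rw [hpos r h]
    exact Finset.le_max' _ _ (Finset.mem_filter.2 ⟨hc, hcr⟩)
  have hρ : ∀ r, ρ r ≤ r := fun r => by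
    by_cases h : 0 ≤ r
    · exact (hmem r h).2
    · rw [hneg r h]; linarith
  -- `δ₂` is halved because the third condition allows a gap of `2δ`; the bound `1` serves the
  -- negative parameters.
  refine ⟨min (min δ₁ (δ₂ / 2)) 1, by positivity, ρ, ?_, hρ, ?_⟩
  · intro r s hrs
    by_cases hr : 0 ≤ r
    · exact hle s (hr.trans hrs) _ (hmem r hr).1 ((hρ r).trans hrs)
    by_cases hs : 0 ≤ s
    · have := hle s hs 0 (by simp) hs
      rw [hneg r hr]; linarith
    · rw [hneg r hr, hneg s hs]; linarith
  · intro c hc r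
    have hδ₁ : min (min δ₁ (δ₂ / 2)) 1 ≤ δ₁ := (min_le_left _ _).trans (min_le_left _ _)
    have hδ₂ : min (min δ₁ (δ₂ / 2)) 1 ≤ δ₂ / 2 := (min_le_left _ _).trans (min_le_right _ _)
    have hδ₃ : min (min δ₁ (δ₂ / 2)) 1 ≤ 1 := min_le_right _ _
    have hc0 := hC c hc
    have hc' : c ∈ insert 0 C := Finset.mem_insert_of_mem hc
    by_cases hr : 0 ≤ r
    · refine ⟨hle r hr c hc', fun h => H₁ _ (hmem r hr).1 c hc' (by linarith), fun h => ?_⟩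
      have := H₂ _ (hmem r hr).1 c hc' (by linarith)
      linarith
    · rw [hneg r hr]
      refine ⟨fun h => ?_, fun h => ?_, fun h => ?_⟩ <;> linarith

theorem nonempty_interleaving_of_interleavingDist_eq {K : Type u} [Field K]
    {X : Type v} [Finite X] [LinearOrder X] (D : Dissimilarity X)
    {Y : Type w} [Finite Y] [LinearOrder Y] (E : Dissimilarity Y) (k : ℕ) {ε : ℝ≥0}
    (hε : interleavingDist (D.persistentHomology K k) (E.persistentHomology K k) = ε) :
    Nonempty (Interleaving ε (D.persistentHomology K k) (E.persistentHomology K k)) := by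
  classical
  have := Fintype.ofFinite X
  have := Fintype.ofFinite Y
  let C : Finset ℝ := Finset.univ.image (fun p : X × X => D.d p.1 p.2) ∪
    Finset.univ.image (fun p : Y × Y => E.d p.1 p.2)
  have hD : ∀ x y, D.d x y ∈ C := fun x y =>
    Finset.mem_union_left _ (Finset.mem_image.2 ⟨(x, y), Finset.mem_univ _, rfl⟩)
  have hE : ∀ x y, E.d x y ∈ C := fun x y =>
    Finset.mem_union_right _ (Finset.mem_image.2 ⟨(x, y), Finset.mem_univ _, rfl⟩)
  have hC : ∀ c ∈ C, 0 ≤ c := by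
    intro c hc
    rcases Finset.mem_union.1 hc with h | h <;> obtain ⟨p, -, rfl⟩ := Finset.mem_image.1 h
    · exact D.nonneg _ _
    · exact E.nonneg _ _
  obtain ⟨δ, hδ, ρ, hmono, hρ, H⟩ := exists_monotone_floor C hC ε.coe_nonneg
  have hlt : interleavingDist (D.persistentHomology K k) (E.persistentHomology K k) <
      ((ε + δ.toNNReal : ℝ≥0) : ℝ≥0∞) := by
    rw [hε, ENNReal.coe_lt_coe]
    exact lt_add_of_pos_right _ (Real.toNNReal_pos.2 hδ)
  obtain ⟨ε', hΦ, hlt⟩ := by simpa only [interleavingDist, iInf_lt_iff] using hlt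
  obtain ⟨Φ⟩ := hΦ
  have hle : ε ≤ ε' := by
    rw [← ENNReal.coe_le_coe, ← hε]
    exact iInf₂_le ε' ⟨Φ⟩
  have hlt' : (ε' : ℝ) < ε + δ := by
    have := NNReal.coe_lt_coe.2 (ENNReal.coe_lt_coe.1 hlt)
    rwa [NNReal.coe_add, Real.coe_toNNReal _ hδ.le] at this
  refine Φ.nonempty_of_stable (NNReal.coe_le_coe.2 hle) hmono hρ
    (fun r => D.bijective_map_persistentHomology K k _ fun x y => (H _ (hD x y) r).1)
    (fun r => E.bijective_map_persistentHomology K k _ fun x y => (H _ (hE x y) r).1)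
    (fun r => D.bijective_map_persistentHomology K k _ fun x y h =>
      (H _ (hD x y) r).2.1 (by linarith))
    (fun r => E.bijective_map_persistentHomology K k _ fun x y h =>
      (H _ (hE x y) r).2.1 (by linarith))
    (fun r => (D.bijective_map_persistentHomology K k _ fun x y h =>
      (H _ (hD x y) r).2.2 (by linarith)).1)
    (fun r => (E.bijective_map_persistentHomology K k _ fun x y h =>
      (H _ (hE x y) r).2.2 (by linarith)).1)

/-! ### Selected pairs under an interleaving -/

namespace IntervalDecomposition

variable {K : Type u} [Field K] {V : PersistenceSpace.{u, v} K}

section Evaluation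

variable {ι : Type w} (P : IntervalDecomposition V ι)

open Classical in
/-- The linear combination at parameter `r` of the generators that are born by then. -/
noncomputable def eval (r : ℝ) : (ι →₀ K) →ₗ[K] V.obj r :=
  Finsupp.linearCombination K fun i => if h : P.birth i ≤ r then V.map h (P.gen i) else 0

theorem eval_single {r : ℝ} {i : ι} (h : P.birth i ≤ r) (a : K) :
    P.eval r (Finsupp.single i a) = a • V.map h (P.gen i) := by
  rw [eval, Finsupp.linearCombination_single, dif_pos h]

theorem basis_apply (r : ℝ) (i : {i : ι // P.birth i ≤ r ∧ (r : EReal) < P.death i}) :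
    P.basis r i = V.map i.2.1 (P.gen i.1) :=
  Module.Basis.mk_apply _ _ _

/-- Generators that are unborn or dead at `r` contribute `0`, and the others are the basis vectors.
-/
theorem repr_eval {r : ℝ} {i : ι} (h : P.birth i ≤ r ∧ (r : EReal) < P.death i) (l : ι →₀ K) :
    (P.basis r).repr (P.eval r l) ⟨i, h⟩ = l i := by
  classical
  induction l using Finsupp.induction_linear with
  | zero => simp
  | add f g hf hg => simp [hf, hg]
  | single j a =>
    by_cases hj : P.birth j ≤ r
    · rw [P.eval_single hj]
      by_cases hd : (r : EReal) < P.death j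
      · rw [← P.basis_apply r ⟨j, hj, hd⟩, map_smul, Module.Basis.repr_self]
        simp [Finsupp.single_apply]
      · rw [P.map_gen_eq_zero j r hj (not_lt.1 hd), Finsupp.single_eq_of_ne]
        · simp
        · rintro rfl
          exact hd h.2
    · rw [eval, Finsupp.linearCombination_single, dif_neg hj, Finsupp.single_eq_of_ne]
      · simp
      · rintro rfl
        exact hj h.1

/-- The coefficients of `x`, as a function on all persistence pairs. -/
noncomputable def coeffs (r : ℝ) (x : V.obj r) : ι →₀ K :=
  ((P.basis r).repr x).mapDomain Subtype.val

theorem hasComponent_of_coeffs_ne_zero {r : ℝ} {x : V.obj r} {i : ι} (h : P.coeffs r x i ≠ 0) :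
    P.HasComponent r x i := by
  by_cases hi : P.birth i ≤ r ∧ (r : EReal) < P.death i
  · refine ⟨hi, ?_⟩
    rw [coeffs] at h
    rwa [← Finsupp.mapDomain_apply Subtype.val_injective ((P.basis r).repr x) ⟨i, hi⟩]
  · refine absurd (Finsupp.mapDomain_of_notMem_range _ _ ?_) h
    rintro ⟨j, rfl⟩
    exact hi j.2

/-- Coefficients taken at `r` still describe the class at every later `s`. This lets classes living
at different parameters be compared as vectors in one space. -/
theorem eval_coeffs {r s : ℝ} (h : r ≤ s) (x : V.obj r) :
    P.eval s (P.coeffs r x) = V.map h x := by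
  rw [coeffs]
  conv_rhs => rw [← (P.basis r).linearCombination_repr x]
  generalize (P.basis r).repr x = l
  induction l using Finsupp.induction_linear with
  | zero => simp
  | add f g hf hg => simp [Finsupp.mapDomain_add, hf, hg]
  | single j a =>
    rw [Finsupp.mapDomain_single, P.eval_single (j.2.1.trans h),
      Finsupp.linearCombination_single, map_smul, basis_apply, V.map_map]

theorem isSelected_iff {ε : ℝ≥0} {i : ι} :
    P.IsSelected ε i ↔ ((P.birth i + ε + ε : ℝ) : EReal) < P.death i := by
  rw [IsSelected, length, EReal.lt_sub_iff_add_lt (by simp) (by simp), ← EReal.coe_add]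
  ring_nf

end Evaluation

variable {W : PersistenceSpace.{u, w} K}

/-- If a combination of generators at parameter `r` is killed by the interleaving, then the
generators that survive for at least `2ε` after `r` do not occur in it. -/
theorem eq_zero_of_f_eval_eq_zero {ι : Type*} (P : IntervalDecomposition V ι) {ε : ℝ≥0}
    (Φ : Interleaving ε V W) {r : ℝ} {l : ι →₀ K} (hl : ∀ i ∈ l.support, P.birth i ≤ r)
    (h : Φ.f r (P.eval r l) = 0) {i : ι} (hi : P.birth i ≤ r)
    (hd : ((r + ε + ε : ℝ) : EReal) < P.death i) : l i = 0 := by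
  have h1 : P.eval (r + ε + ε) l = V.map (le_add_shift r ε) (P.eval r l) := by
    rw [eval, eval, Finsupp.linearCombination_apply, Finsupp.linearCombination_apply,
      Finsupp.sum, Finsupp.sum, map_sum]
    refine Finset.sum_congr rfl fun j hj => ?_
    rw [dif_pos (hl j hj), dif_pos ((hl j hj).trans (le_add_shift r ε)), map_smul, V.map_map]
  rw [← P.repr_eval ⟨hi.trans (le_add_shift r ε), hd⟩ l, h1, ← Φ.g_f, h, map_zero, LinearEquiv.map_zero,
    Finsupp.zero_apply]

theorem linearIndependent_coeffs {ι κ : Type*} (P : IntervalDecomposition V ι)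
    (Q : IntervalDecomposition W κ) {ε : ℝ≥0} (Φ : Interleaving ε V W) :
    LinearIndependent K fun i : {i : ι // P.IsSelected ε i} =>
      Q.coeffs (P.birth i + ε) (Φ.f (P.birth i) (P.gen i)) := by
  rw [linearIndependent_iff]
  intro l hl
  by_contra hne
  -- At the latest birth in the relation all its generators exist, and the pair `m`, being selected,
  -- survives a further `2ε`; so its coefficient must vanish.
  obtain ⟨m, hm, hmax⟩ := Finset.exists_max_image l.support (fun i => P.birth i.1)
    (Finsupp.support_nonempty_iff.2 hne)
  refine Finsupp.mem_support_iff.1 hm ?_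
  have hf : Φ.f (P.birth m) (P.eval (P.birth m) (l.mapDomain Subtype.val)) = 0 := by
    rw [← map_zero (Q.eval (P.birth m + ε)), ← hl, eval, Finsupp.linearCombination_mapDomain,
      Finsupp.linearCombination_apply, Finsupp.linearCombination_apply, Finsupp.sum, Finsupp.sum,
      map_sum, map_sum]
    refine Finset.sum_congr rfl fun i hi => ?_
    rw [map_smul, map_smul, Q.eval_coeffs (add_le_add_left (hmax i hi) (ε : ℝ)),
      ← Φ.f_natural (hmax i hi), Function.comp_apply, dif_pos (hmax i hi)]
  rw [← Finsupp.mapDomain_apply Subtype.val_injective l m]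
  refine P.eq_zero_of_f_eval_eq_zero Φ (fun i hi => ?_) hf le_rfl (P.isSelected_iff.1 m.2)
  classical
  obtain ⟨j, hj, rfl⟩ := Finset.mem_image.1 (Finsupp.mapDomain_support hi)
  exact hmax j hj

end IntervalDecomposition

/-- A linearly independent family of finitely supported functions has a system of distinct
representatives for the supports. -/
theorem LinearIndependent.exists_injective_apply_ne_zero {K ι κ : Type*} [Field K]
    {a : ι → κ →₀ K} (ha : LinearIndependent K a) :
    ∃ φ : ι → κ, Function.Injective φ ∧ ∀ i, a i (φ i) ≠ 0 := by
  classical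
  -- Hall's condition: the vectors indexed by `s` are independent and lie in the span of the `|N|`
  -- coordinate vectors of their joint support, so `|s| ≤ |N|`.
  obtain ⟨φ, hφ, h⟩ := (Finset.all_card_le_biUnion_card_iff_exists_injective
    fun i => (a i).support).1 fun s => by
      let N := s.biUnion fun i => (a i).support
      have hle : Set.range (fun i : s => a i) ≤
          Submodule.span K ((N.image fun j => Finsupp.single j (1 : K) : Finset (κ →₀ K)) :
            Set (κ →₀ K)) := by
        rintro _ ⟨i, rfl⟩
        rw [Finset.coe_image, ← Finsupp.supported_eq_span_single, SetLike.mem_coe,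
          Finsupp.mem_supported, Finset.coe_subset]
        exact Finset.subset_biUnion_of_mem (fun i => (a i).support) i.2
      have := linearIndependent_le_span_aux' _ (ha.comp _ Subtype.val_injective) _ hle
      rw [Fintype.card_coe] at this
      refine this.trans ?_
      simpa only [Fintype.card_coe, Finset.coe_sort_coe] using Finset.card_image_le
  exact ⟨φ, hφ, fun i => Finsupp.mem_support_iff.1 (h i)⟩

theorem proposition1 {K : Type*} [Field K]
    {X : Type*} [Finite X] [LinearOrder X] (dX : Dissimilarity X)
    {Y : Type*} [Finite Y] [LinearOrder Y] (dY : Dissimilarity Y)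
    (k : ℕ) (ε : ℝ≥0)
    (hε : interleavingDist (dY.persistentHomology K k) (dX.persistentHomology K k) = ε) :
    Nonempty (Interleaving ε (dY.persistentHomology K k) (dX.persistentHomology K k)) ∧
    ∀ (Φ : Interleaving ε (dY.persistentHomology K k) (dX.persistentHomology K k))
      {ι : Type*} (P : IntervalDecomposition (dY.persistentHomology K k) ι),
      (∀ i, P.IsSelected ε i → Φ.f (P.birth i) (P.gen i) ≠ 0) ∧
      (∀ i j, P.IsSelected ε i → P.IsSelected ε j → i ≠ j →
        (dX.persistentHomology K k).map (le_max_left (P.birth i + ε) (P.birth j + ε))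
            (Φ.f (P.birth i) (P.gen i)) ≠
          (dX.persistentHomology K k).map (le_max_right (P.birth i + ε) (P.birth j + ε))
            (Φ.f (P.birth j) (P.gen j))) ∧
      (∀ {κ : Type*} (Q : IntervalDecomposition (dX.persistentHomology K k) κ),
        ∃ φ : {i : ι // P.IsSelected ε i} → κ, Function.Injective φ ∧
          ∀ i : {i : ι // P.IsSelected ε i},
            Q.HasComponent (P.birth i.1 + ε) (Φ.f (P.birth i.1) (P.gen i.1)) (φ i)) := by
  refine ⟨nonempty_interleaving_of_interleavingDist_eq dY dX k hε, fun Φ {ι} P => ⟨?_, ?_, ?_⟩⟩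
  · intro i hi h
    refine one_ne_zero (α := K) ?_
    rw [← Finsupp.single_eq_same (a := i) (b := (1 : K))]
    refine P.eq_zero_of_f_eval_eq_zero Φ (r := P.birth i) (fun j hj => ?_) ?_ le_rfl
      (P.isSelected_iff.1 hi)
    · rw [Finset.mem_singleton.1 (Finsupp.support_single_subset hj)]
    · rw [P.eval_single le_rfl, one_smul, PersistenceSpace.map_self, h]
  · intro i j hi hj hij h
    classical
    -- Passing to `max (b_i, b_j) + ε` lets naturality of `f` bring both classes under the single
    -- map `Φ.f` at `max (b_i, b_j)`.
    replace h := congrArg ((dX.persistentHomology K k).map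
      (max_add_add_right (P.birth i) (P.birth j) (ε : ℝ)).le) h
    rw [PersistenceSpace.map_map, PersistenceSpace.map_map, ← Φ.f_natural (le_max_left _ _),
      ← Φ.f_natural (le_max_right _ _)] at h
    have key := fun m => P.eq_zero_of_f_eval_eq_zero Φ (r := max (P.birth i) (P.birth j))
      (l := Finsupp.single i 1 - Finsupp.single j 1) (fun m hm => by
        rcases Finset.mem_union.1 (Finsupp.support_sub hm) with hm | hm <;>
          rw [Finset.mem_singleton.1 (Finsupp.support_single_subset hm)]
        exacts [le_max_left _ _, le_max_right _ _]) (by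
        rw [map_sub, P.eval_single (le_max_left _ _), P.eval_single (le_max_right _ _), one_smul,
          one_smul, map_sub, h, sub_self]) (i := m)
    -- The later-born pair is known to outlive the maximum of the births by `2ε`; its coefficient
    -- `±1` would have to be zero.
    rcases le_total (P.birth i) (P.birth j) with hle | hle
    · have := key j (le_max_right _ _) (by rw [max_eq_right hle]; exact P.isSelected_iff.1 hj)
      simp [hij] at this
    · have := key i (le_max_left _ _) (by rw [max_eq_left hle]; exact P.isSelected_iff.1 hi)
      simp [hij] at this
  · intro κ Q
    obtain ⟨φ, hφ, h⟩ := (P.linearIndependent_coeffs Q Φ).exists_injective_apply_ne_zero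
    exact ⟨φ, hφ, fun i => Q.hasComponent_of_coeffs_ne_zero (h i)⟩
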